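/- Let $f:X\to S$ be a continuous map of topological spaces which is locally topologically trivial over $S$, with fibers $X_t=f^{-1}(t)$. Let $H_j$ and $H^j$ denote singular homology and cohomology with $\mathbf{Q}$-coefficients, let $\langle\ ,\ \rangle: H^j(A)\times H_j(A)\to\mathbf{Q}$ be the canonical pairing (the value of a cocycle on a cycle), and assume that $H_j(X_t)$ and $H^j(X_t)$ are finite dimensional for all $t\in S$ and all $j\ge 0$. Let $s\in S$, let $\gamma:[0,1]\to S$ be a loop based at $s$, and let $\rho:Y=[0,1]\times_S X\to[0,1]$ be the base change of $f$ by $\gamma$, with fibers $Y_u=\rho^{-1}(u)$, so that $Y_0=X_s=Y_1$. A geometric monodromy of $\gamma$ is a homeomorphism $\gamma_\#:X_s=Y_0\simeq Y_1=X_s$ induced by a trivialization $Y\simeq[0,1]\times F$ over $[0,1]$; it induces $\gamma_*$ on $H_j(X_s)$ and $\gamma^*$ on $H^j(X_s)$. The groups $H_j(Y_u)$ form a local system on $[0,1]$, whose sections are the families $a_u\in H_j(Y_u)$ such that each point of $[0,1]$ has an open neighborhood $U$ for which the image of $a_u$ in $H_j(\rho^{-1}(U))$ is the same for all $u\in U$.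 The groups $H^j(Y_u)$ form a local system on $[0,1]$, whose sections are the families $a_u\in H^j(Y_u)$ such that each point of $[0,1]$ has an open neighborhood $U$ and a class in $H^j(\rho^{-1}(U))$ which restricts to $a_u$ for all $u\in U$. The local system monodromies $\gamma_h$ on $H_j(X_s)$ and $\gamma_c$ on $H^j(X_s)$ are the maps that send the value at $0$ of each section over $[0,1]$ to its value at $1$, via $Y_0=X_s=Y_1$. Then a geometric monodromy of $\gamma$ exists. For every $j\ge 0$ the pairing between $H^j(X_s)$ and $H_j(X_s)$ is perfect, and $\gamma_h\in\mathrm{Aut}(H_j(X_s))$ and $\gamma_c\in\mathrm{Aut}(H^j(X_s))$ are well defined and satisfy $$\langle\gamma_c x,\gamma_h y\rangle=\langle x,y\rangle\qquad\text{for all }x\in H^j(X_s),\ y\in H_j(X_s).$$ For every choice of the geometric monodromy $\gamma_\#$ one has $$\gamma_*=\gamma_h,\qquad \gamma^*=\gamma_c^{-1},\qquad \gamma^*={}^t\gamma_*,$$ where the last equality means $\langle\gamma^*x,y\rangle=\langle x,\gamma_*y\rangle$ for all $x\in H^j(X_s)$, $y\in H_j(X_s)$. -/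

import Mathlib

open CategoryTheory Topology unitInterval

universe u v

noncomputable section

namespace Monodromy

/-! ### Singular homology and cohomology with rational coefficients, and their pairing -/

/-- The coefficient module `ℚ`, placed in the universe of the spaces under consideration. -/
abbrev coeff : ModuleCat.{u} ℚ := ModuleCat.of ℚ (ULift.{u} ℚ)

/-- The complex of rational singular chains, as a functor. -/
abbrev chains : TopCat.{u} ⥤ ChainComplex (ModuleCat.{u} ℚ) ℕ :=
  (AlgebraicTopology.singularChainComplexFunctor (ModuleCat.{u} ℚ)).obj coeff

/-- The complex of rational singular cochains `Hom(C_•(A), ℚ)`. -/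
abbrev cochains (A : TopCat.{u}) : CochainComplex (ModuleCat.{u} ℚ) ℕ :=
  (chains.obj A).linearYonedaObj ℚ coeff

/-- The map of singular cochain complexes given by precomposition with the map of chains. -/
def cochainsMap {A B : TopCat.{u}} (φ : A ⟶ B) : cochains B ⟶ cochains A where
  f n := ((linearYoneda ℚ (ModuleCat.{u} ℚ)).obj coeff).map ((chains.map φ).f n).op
  comm' i j _ := by
    change ((linearYoneda ℚ (ModuleCat.{u} ℚ)).obj coeff).map _ ≫
        ((linearYoneda ℚ (ModuleCat.{u} ℚ)).obj coeff).map _ =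
      ((linearYoneda ℚ (ModuleCat.{u} ℚ)).obj coeff).map _ ≫
        ((linearYoneda ℚ (ModuleCat.{u} ℚ)).obj coeff).map _
    rw [← Functor.map_comp, ← Functor.map_comp, ← op_comp, ← op_comp,
      (chains.map φ).comm]

/-- Singular homology `H_j(A; ℚ)`. -/
abbrev H (j : ℕ) (A : Type u) [TopologicalSpace A] : ModuleCat.{u} ℚ :=
  ((AlgebraicTopology.singularHomologyFunctor (ModuleCat.{u} ℚ) j).obj coeff).obj (TopCat.of A)

/-- Singular cohomology `H^j(A; ℚ)`. -/
abbrev coH (j : ℕ) (A : Type u) [TopologicalSpace A] : ModuleCat.{u} ℚ :=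
  (cochains (TopCat.of A)).homology j

variable {A B : Type u} [TopologicalSpace A] [TopologicalSpace B]

/-- The map `φ_* : H_j(A) → H_j(B)` induced by a continuous map. -/
def push (j : ℕ) (φ : C(A, B)) : H j A →ₗ[ℚ] H j B :=
  (((AlgebraicTopology.singularHomologyFunctor (ModuleCat.{u} ℚ) j).obj coeff).map
    (TopCat.ofHom φ)).hom

/-- The map `φ^* : H^j(B) → H^j(A)` induced by a continuous map. -/
def pull (j : ℕ) (φ : C(A, B)) : coH j B →ₗ[ℚ] coH j A :=
  (HomologicalComplex.homologyMap (cochainsMap (TopCat.ofHom φ)) j).hom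

/-- The cochain underlying a cocycle. -/
def cocycleHom (j : ℕ) (A : TopCat.{u}) :
    (cochains A).cycles j →ₗ[ℚ] ((chains.obj A).X j ⟶ coeff.{u}) :=
  ((cochains A).iCycles j).hom

lemma d_comp_cocycleHom (j : ℕ) (A : TopCat.{u}) (z : (cochains A).cycles j) :
    (chains.obj A).d (j + 1) j ≫ cocycleHom j A z = 0 := by
  have h := (cochains A).iCycles_d j (j + 1)
  exact congrArg (fun m => m.hom z) h

/-- A cocycle, as a linear form on homology: it sends the class of a cycle to the value of the
cocycle on that cycle. -/
def cocycleEval (j : ℕ) (A : TopCat.{u}) (z : (cochains A).cycles j) :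
    (chains.obj A).homology j ⟶ coeff.{u} :=
  (chains.obj A).homologyι j ≫
    (chains.obj A).descOpcycles (cocycleHom j A z) (j + 1) (by simp) (d_comp_cocycleHom j A z)

lemma homologyπ_comp_cocycleEval (j : ℕ) (A : TopCat.{u}) (z : (cochains A).cycles j) :
    (chains.obj A).homologyπ j ≫ cocycleEval j A z =
      (chains.obj A).iCycles j ≫ cocycleHom j A z := by
  simp [cocycleEval]

/-- `cocycleEval` as a linear map to the rational dual of homology. -/
def cocyclePairing (j : ℕ) (A : TopCat.{u}) :
    (cochains A).cycles j →ₗ[ℚ] Module.Dual ℚ ((chains.obj A).homology j) where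
  toFun z := ULift.moduleEquiv.toLinearMap ∘ₗ (cocycleEval j A z).hom
  map_add' z w := by
    have : cocycleEval j A (z + w) = cocycleEval j A z + cocycleEval j A w := by
      rw [← cancel_epi ((chains.obj A).homologyπ j)]
      simp [homologyπ_comp_cocycleEval, Preadditive.comp_add]
    rw [this]; ext; rfl
  map_smul' c z := by
    have : cocycleEval j A (c • z) = c • cocycleEval j A z := by
      rw [← cancel_epi ((chains.obj A).homologyπ j)]
      simp [homologyπ_comp_cocycleEval, Linear.comp_smul]
    rw [this]; ext; rfl

lemma toCycles_comp_cocyclePairing (i j : ℕ) (A : TopCat.{u}) :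
    (cochains A).toCycles i j ≫ ModuleCat.ofHom (cocyclePairing j A) = 0 := by
  ext ψ : 2
  have h1 : cocycleHom j A (((cochains A).toCycles i j).hom ψ) =
      (chains.obj A).d j i ≫ (show (chains.obj A).X i ⟶ coeff.{u} from ψ) :=
    congrArg (fun m => m.hom ψ) ((cochains A).toCycles_i i j)
  have h2 : cocycleEval j A (((cochains A).toCycles i j).hom ψ) = 0 := by
    rw [← cancel_epi ((chains.obj A).homologyπ j), homologyπ_comp_cocycleEval, h1,
      HomologicalComplex.iCycles_d_assoc, Limits.zero_comp, Limits.comp_zero]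
  change ULift.moduleEquiv.toLinearMap ∘ₗ
    (cocycleEval j A (((cochains A).toCycles i j).hom ψ)).hom = 0
  rw [h2]; ext; rfl

/-- The canonical pairing `⟨·, ·⟩ : H^j(A) × H_j(A) → ℚ`, the value of a cocycle on a cycle. -/
def pairing (j : ℕ) (A : Type u) [TopologicalSpace A] :
    coH j A →ₗ[ℚ] H j A →ₗ[ℚ] ℚ :=
  (((cochains (TopCat.of A)).sc j).descHomology
    (ModuleCat.ofHom (cocyclePairing j (TopCat.of A)))
    (toCycles_comp_cocyclePairing _ j (TopCat.of A))).hom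

/-- The pairing of the class of a cocycle with the class of a cycle. -/
lemma pairing_apply (j : ℕ) (A : Type u) [TopologicalSpace A]
    (z : (cochains (TopCat.of A)).cycles j) (c : (chains.obj (TopCat.of A)).cycles j) :
    pairing j A (((cochains (TopCat.of A)).homologyπ j).hom z)
        (((chains.obj (TopCat.of A)).homologyπ j).hom c) =
      ((cocycleHom j (TopCat.of A) z).hom (((chains.obj (TopCat.of A)).iCycles j).hom c)).down := by
  have h1 : pairing j A (((cochains (TopCat.of A)).homologyπ j).hom z) =
      cocyclePairing j (TopCat.of A) z :=
    congrArg (fun m => m.hom z) (((cochains (TopCat.of A)).sc j).π_descHomology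
      (ModuleCat.ofHom (cocyclePairing j (TopCat.of A)))
      (toCycles_comp_cocyclePairing _ j (TopCat.of A)))
  rw [h1]
  exact congrArg (fun m => (m.hom c).down) (homologyπ_comp_cocycleEval j (TopCat.of A) z)

/-! ### Locally trivial maps and base change by a loop -/

/-- The fiber of a map over a point, with the subspace topology. -/
abbrev Fiber {X : Type u} {S : Type v} (f : X → S) (s : S) : Type u := f ⁻¹' {s}

/-- `f : X → S` is locally topologically trivial: each point `s` of `S` has an open neighborhood
over which `f` is a product with fiber `f ⁻¹ (s)`. The fibers over different connected components
of `S` may differ. -/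
def IsLocallyTrivial {X : Type u} {S : Type v} [TopologicalSpace X] [TopologicalSpace S]
    (f : X → S) : Prop :=
  ∀ s : S, ∃ e : Bundle.Trivialization (Fiber f s) f, s ∈ e.baseSet

section Loop

variable {X : Type u} {S : Type v} [TopologicalSpace X] [TopologicalSpace S]
  (f : X → S) {s : S} (γ : Path s s)

/-- The base change `Y = [0,1] ×_S X` of `f` by `γ`. -/
abbrev BaseChange : Type u := {p : I × X // γ p.1 = f p.2}

/-- The projection `ρ : Y → [0,1]`. -/
def proj (y : BaseChange f γ) : I := y.1.1

/-- The identification `X_s = Y_t` for a parameter `t` with `γ t = s`. -/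
def fiberIdent (t : I) (ht : γ t = s) : Fiber f s ≃ₜ Fiber (proj f γ) t where
  toFun x := ⟨⟨(t, x.1), ht.trans x.2.symm⟩, rfl⟩
  invFun y := ⟨y.1.1.2, by
    have h1 : y.1.1.1 = t := y.2
    have h2 := y.1.2
    rw [h1, ht] at h2
    exact h2.symm⟩
  left_inv x := rfl
  right_inv y := Subtype.ext (Subtype.ext (Prod.ext (Eq.symm y.2) rfl))
  continuous_toFun := by fun_prop
  continuous_invFun := by fun_prop

/-- The identification `X_s = Y_0`. -/
abbrev identZero : Fiber f s ≃ₜ Fiber (proj f γ) 0 := fiberIdent f γ 0 γ.source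

/-- The identification `X_s = Y_1`. -/
abbrev identOne : Fiber f s ≃ₜ Fiber (proj f γ) 1 := fiberIdent f γ 1 γ.target

/-- `g` is a geometric monodromy `γ_#` of `f` along `γ`: it is the homeomorphism
`X_s = Y_0 ≃ Y_1 = X_s` given by some trivialization `Φ : Y ≃ [0,1] × F` over `[0,1]`. -/
def IsGeometricMonodromy (g : Fiber f s ≃ₜ Fiber f s) : Prop :=
  ∃ (F : Type u) (_ : TopologicalSpace F) (Φ : BaseChange f γ ≃ₜ I × F),
    (∀ y, (Φ y).1 = proj f γ y) ∧
    ∀ x, (Φ (identOne f γ (g x)).1).2 = (Φ (identZero f γ x).1).2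

end Loop

/-! ### The local systems of homology and cohomology groups of the fibers -/

section LocalSystem

variable {Y : Type u} {T : Type v} [TopologicalSpace Y] [TopologicalSpace T] (ρ : Y → T)

/-- The inclusion of the fiber `Y_t` into `ρ ⁻¹ (U)`, for `t ∈ U`. -/
def fiberIncl (U : Set T) (t : T) (ht : t ∈ U) : C(Fiber ρ t, ρ ⁻¹' U) where
  toFun y := ⟨y.1, by
    have h : ρ y.1 = t := y.2
    simpa [h] using ht⟩
  continuous_toFun := by fun_prop

/-- Sections of the local system `{H_j(Y_t)}`: families of classes which, near each point of the
base, have the same image in the homology of the part of `Y` over a neighborhood. -/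
def IsHomologySection (j : ℕ) (a : ∀ t : T, H j (Fiber ρ t)) : Prop :=
  ∀ t₀ : T, ∃ U : Set T, IsOpen U ∧ t₀ ∈ U ∧ ∃ c : H j (ρ ⁻¹' U),
    ∀ (t : T) (ht : t ∈ U), push j (fiberIncl ρ U t ht) (a t) = c

/-- Sections of the local system `{H^j(Y_t)}`: families of classes which, near each point of the
base, are the restrictions of one class on the part of `Y` over a neighborhood. -/
def IsCohomologySection (j : ℕ) (a : ∀ t : T, coH j (Fiber ρ t)) : Prop :=
  ∀ t₀ : T, ∃ U : Set T, IsOpen U ∧ t₀ ∈ U ∧ ∃ c : coH j (ρ ⁻¹' U),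
    ∀ (t : T) (ht : t ∈ U), a t = pull j (fiberIncl ρ U t ht) c

end LocalSystem

section LocalSystemMonodromy

variable {X : Type u} {S : Type v} [TopologicalSpace X] [TopologicalSpace S]
  (f : X → S) {s : S} (γ : Path s s)

/-- `γh` is the monodromy `H_j(X_s) = H_j(Y_0) ≃ H_j(Y_1) = H_j(X_s)` of the local system
`{H_j(Y_t)}` on `[0,1]`: `γh x = x'` exactly when a section of the local system over `[0,1]` goes
from `x` at `0` to `x'` at `1`. There is at most one such `γh`. -/
def IsHomologyMonodromy (j : ℕ) (γh : H j (Fiber f s) ≃ₗ[ℚ] H j (Fiber f s)) : Prop :=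
  ∀ x x', γh x = x' ↔ ∃ a : ∀ t : I, H j (Fiber (proj f γ) t), IsHomologySection (proj f γ) j a ∧
    a 0 = push j (identZero f γ : C(Fiber f s, Fiber (proj f γ) 0)) x ∧
    a 1 = push j (identOne f γ : C(Fiber f s, Fiber (proj f γ) 1)) x'

/-- `γc` is the monodromy `H^j(X_s) = H^j(Y_0) ≃ H^j(Y_1) = H^j(X_s)` of the local system
`{H^j(Y_t)}` on `[0,1]`: `γc x = x'` exactly when a section of the local system over `[0,1]` goes
from `x` at `0` to `x'` at `1`. There is at most one such `γc`. -/
def IsCohomologyMonodromy (j : ℕ) (γc : coH j (Fiber f s) ≃ₗ[ℚ] coH j (Fiber f s)) : Prop :=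
  ∀ x x', γc x = x' ↔
    ∃ a : ∀ t : I, coH j (Fiber (proj f γ) t), IsCohomologySection (proj f γ) j a ∧
    pull j (identZero f γ : C(Fiber f s, Fiber (proj f γ) 0)) (a 0) = x ∧
    pull j (identOne f γ : C(Fiber f s, Fiber (proj f γ) 1)) (a 1) = x'

end LocalSystemMonodromy

end Monodromy

end

/-!
After base change to `[0,1]` all fibers are homeomorphic to one space `F`, and the local
trivializations, taken with fiber `F`, glue along a subdivision of `[0,1]`, so that the family
becomes a product `[0,1] × F`. By homotopy invariance the sections of either local system of a
product family are the constant families. The monodromy of the local system is therefore the map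
induced by any trivialization; in particular all trivializations induce the same map.

Since `ℚ` is injective, `H^j(A)` is the full dual of `H_j(A)`, and pulling back cohomology classes
is the transpose of pushing forward homology classes. Homotopy invariance in cohomology is thus a
consequence of the one in homology.
-/

noncomputable section

namespace Monodromy

section Duality

variable {A B C : Type u} [TopologicalSpace A] [TopologicalSpace B] [TopologicalSpace C]

lemma push_id (j : ℕ) : push j (ContinuousMap.id A) = LinearMap.id :=
  congrArg ModuleCat.Hom.hom (CategoryTheory.Functor.map_id
    ((AlgebraicTopology.singularHomologyFunctor (ModuleCat.{u} ℚ) j).obj coeff) (TopCat.of A))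

lemma push_comp (j : ℕ) (ψ : C(B, C)) (φ : C(A, B)) :
    push j (ψ.comp φ) = push j ψ ∘ₗ push j φ :=
  congrArg ModuleCat.Hom.hom (CategoryTheory.Functor.map_comp
    ((AlgebraicTopology.singularHomologyFunctor (ModuleCat.{u} ℚ) j).obj coeff)
    (TopCat.ofHom φ) (TopCat.ofHom ψ))

lemma push_congr (j : ℕ) {φ ψ : C(A, B)} (h : φ.Homotopic ψ) : push j φ = push j ψ :=
  h.elim fun h => congrArg ModuleCat.Hom.hom
    (TopCat.Homotopy.congr_homologyMap_singularChainComplexFunctor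
      (f := TopCat.ofHom φ) (g := TopCat.ofHom ψ) h coeff.{u} j)

lemma exists_cocycle_eq (j : ℕ) (x : coH j A) :
    ∃ z, ((cochains (TopCat.of A)).homologyπ j).hom z = x :=
  (ModuleCat.epi_iff_surjective ((cochains (TopCat.of A)).homologyπ j)).1 inferInstance x

lemma exists_cycle_eq (j : ℕ) (y : H j A) :
    ∃ c, ((chains.obj (TopCat.of A)).homologyπ j).hom c = y :=
  (ModuleCat.epi_iff_surjective ((chains.obj (TopCat.of A)).homologyπ j)).1 inferInstance y

lemma push_homologyπ (j : ℕ) (φ : C(A, B)) (c : (chains.obj (TopCat.of A)).cycles j) :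
    push j φ (((chains.obj (TopCat.of A)).homologyπ j).hom c) =
      ((chains.obj (TopCat.of B)).homologyπ j).hom
        ((HomologicalComplex.cyclesMap (chains.map (TopCat.ofHom φ)) j).hom c) :=
  congrArg (fun m => m.hom c)
    (HomologicalComplex.homologyπ_naturality (chains.map (TopCat.ofHom φ)) j)

lemma pull_homologyπ (j : ℕ) (φ : C(A, B)) (z : (cochains (TopCat.of B)).cycles j) :
    pull j φ (((cochains (TopCat.of B)).homologyπ j).hom z) =
      ((cochains (TopCat.of A)).homologyπ j).hom
        ((HomologicalComplex.cyclesMap (cochainsMap (TopCat.ofHom φ)) j).hom z) :=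
  congrArg (fun m => m.hom z)
    (HomologicalComplex.homologyπ_naturality (cochainsMap (TopCat.ofHom φ)) j)

lemma cocycleHom_cyclesMap (j : ℕ) {A B : TopCat.{u}} (φ : A ⟶ B) (z : (cochains B).cycles j) :
    cocycleHom j A ((HomologicalComplex.cyclesMap (cochainsMap φ) j).hom z) =
      (chains.map φ).f j ≫ cocycleHom j B z :=
  congrArg (fun m => m.hom z) (HomologicalComplex.cyclesMap_i (cochainsMap φ) j)

lemma pairing_pull (j : ℕ) (φ : C(A, B)) (x : coH j B) (y : H j A) :
    pairing j A (pull j φ x) y = pairing j B x (push j φ y) := by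
  obtain ⟨z, rfl⟩ := exists_cocycle_eq j x
  obtain ⟨c, rfl⟩ := exists_cycle_eq j y
  rw [pull_homologyπ, push_homologyπ, pairing_apply, pairing_apply, cocycleHom_cyclesMap]
  exact congrArg (fun m => (cocycleHom j (TopCat.of B) z).hom (m.hom c) |>.down)
    (HomologicalComplex.cyclesMap_i (chains.map (TopCat.ofHom φ)) j).symm

instance injective_coeff : Injective coeff.{u} :=
  have := Module.injective_of_isSemisimpleRing ℚ (ULift.{u} ℚ)
  Module.injective_object_of_injective_module ℚ (ULift.{u} ℚ)

lemma exists_d_comp_eq_of_iCycles_comp_eq_zero {D ι : Type*} [Category* D] [Abelian D]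
    {c : ComplexShape ι} (K : HomologicalComplex D c) {J : D} [Injective J] {i j : ι}
    (hij : c.next i = j) {ψ : K.X i ⟶ J} (hψ : K.iCycles i ≫ ψ = 0) :
    ∃ k : K.X j ⟶ J, K.d i j ≫ k = ψ := by
  have hexact : (ShortComplex.mk (K.iCycles i) (K.d i j) (K.iCycles_d i j)).Exact :=
    ShortComplex.exact_of_f_is_kernel _ (K.cyclesIsKernel i j hij)
  exact ⟨hexact.descToInjective ψ hψ, hexact.comp_descToInjective ψ hψ⟩

lemma exists_cocycleHom_eq_of_d_comp_eq_zero (j : ℕ) {A : TopCat.{u}}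
    {ψ : (chains.obj A).X j ⟶ coeff.{u}} (hψ : (chains.obj A).d (j + 1) j ≫ ψ = 0) :
    ∃ z, cocycleHom j A z = ψ := by
  refine ⟨(cochains A).cyclesMk (show (cochains A).X j from ψ) (j + 1) (by simp) hψ, ?_⟩
  exact (cochains A).i_cyclesMk _ _ _ _

lemma homologyπ_eq_zero_of_d_comp_eq_cocycleHom (j i : ℕ) {A : TopCat.{u}}
    {z : (cochains A).cycles j} {ψ : (chains.obj A).X i ⟶ coeff.{u}}
    (h : (chains.obj A).d j i ≫ ψ = cocycleHom j A z) :
    ((cochains A).homologyπ j).hom z = 0 := by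
  have hz : ((cochains A).toCycles i j).hom ψ = z := by
    apply (ModuleCat.mono_iff_injective ((cochains A).iCycles j)).1 inferInstance
    exact (congrArg (fun m => m.hom ψ) ((cochains A).toCycles_i i j)).trans h
  rw [← hz]
  exact congrArg (fun m => m.hom ψ) ((cochains A).toCycles_comp_homologyπ i j)

lemma pairing_injective (j : ℕ) (A : Type u) [TopologicalSpace A] :
    Function.Injective (pairing j A) := by
  rw [injective_iff_map_eq_zero]
  intro x hx
  obtain ⟨z, rfl⟩ := exists_cocycle_eq j x
  have hz : (chains.obj (TopCat.of A)).iCycles j ≫ cocycleHom j (TopCat.of A) z = 0 := by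
    ext c : 2
    exact ULift.down_injective (by simpa [hx] using! (pairing_apply j A z c).symm)
  obtain ⟨ψ, hψ⟩ := exists_d_comp_eq_of_iCycles_comp_eq_zero _ rfl hz
  exact homologyπ_eq_zero_of_d_comp_eq_cocycleHom j _ hψ

lemma pairing_surjective (j : ℕ) (A : Type u) [TopologicalSpace A] :
    Function.Surjective (pairing j A) := by
  intro l
  let K := chains.obj (TopCat.of A)
  let l' : K.homology j ⟶ coeff.{u} :=
    ModuleCat.ofHom (ULift.moduleEquiv.symm.toLinearMap ∘ₗ l)
  let ψ : K.X j ⟶ coeff.{u} := Injective.factorThru (K.homologyπ j ≫ l') (K.iCycles j)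
  have hψ : K.iCycles j ≫ ψ = K.homologyπ j ≫ l' := Injective.comp_factorThru _ _
  have hd : K.d (j + 1) j ≫ ψ = 0 := by
    rw [← K.toCycles_i (j + 1) j, Category.assoc, hψ, K.toCycles_comp_homologyπ_assoc,
      Limits.zero_comp]
  obtain ⟨z, hz⟩ := exists_cocycleHom_eq_of_d_comp_eq_zero j hd
  refine ⟨((cochains (TopCat.of A)).homologyπ j).hom z, LinearMap.ext fun y => ?_⟩
  obtain ⟨c, rfl⟩ := exists_cycle_eq j y
  rw [pairing_apply, hz]
  exact congrArg (fun m => (m.hom c).down) hψ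

lemma pull_id (j : ℕ) : pull j (ContinuousMap.id A) = LinearMap.id :=
  LinearMap.ext fun x => pairing_injective j A <| LinearMap.ext fun y => by
    rw [pairing_pull, push_id, LinearMap.id_apply, LinearMap.id_apply]

lemma pull_comp (j : ℕ) (ψ : C(B, C)) (φ : C(A, B)) :
    pull j (ψ.comp φ) = pull j φ ∘ₗ pull j ψ :=
  LinearMap.ext fun x => pairing_injective j A <| LinearMap.ext fun y => by
    simp only [pairing_pull, push_comp, LinearMap.comp_apply]

lemma pull_congr (j : ℕ) {φ ψ : C(A, B)} (h : φ.Homotopic ψ) : pull j φ = pull j ψ :=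
  LinearMap.ext fun x => pairing_injective j A <| LinearMap.ext fun y => by
    rw [pairing_pull, pairing_pull, push_congr j h]

/-- The isomorphism `g_*` of homology induced by a homeomorphism. -/
def pushEquiv (j : ℕ) (g : A ≃ₜ B) : H j A ≃ₗ[ℚ] H j B :=
  LinearEquiv.ofLinearMap (push j g) (push j g.symm)
    (by rw [← push_comp, g.toContinuousMap_comp_symm, push_id])
    (by rw [← push_comp, g.symm_comp_toContinuousMap, push_id])

/-- The isomorphism `g^*` of cohomology induced by a homeomorphism. -/
def pullEquiv (j : ℕ) (g : A ≃ₜ B) : coH j B ≃ₗ[ℚ] coH j A :=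
  LinearEquiv.ofLinearMap (pull j g) (pull j g.symm)
    (by rw [← pull_comp, g.symm_comp_toContinuousMap, pull_id])
    (by rw [← pull_comp, g.toContinuousMap_comp_symm, pull_id])

@[simp]
lemma coe_pushEquiv (j : ℕ) (g : A ≃ₜ B) :
    (pushEquiv j g : H j A →ₗ[ℚ] H j B) = push j (g : C(A, B)) := rfl

@[simp]
lemma coe_pullEquiv (j : ℕ) (g : A ≃ₜ B) :
    (pullEquiv j g : coH j B →ₗ[ℚ] coH j A) = pull j (g : C(A, B)) := rfl

lemma pushEquiv_trans_apply (j : ℕ) (g : A ≃ₜ B) (h : B ≃ₜ C) (y : H j A) :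
    pushEquiv j (g.trans h) y = pushEquiv j h (pushEquiv j g y) :=
  LinearMap.congr_fun (push_comp j (h : C(B, C)) (g : C(A, B))) y

lemma pullEquiv_trans_symm_apply (j : ℕ) (g : A ≃ₜ B) (h : B ≃ₜ C) (x : coH j A) :
    (pullEquiv j (g.trans h)).symm x = (pullEquiv j h).symm ((pullEquiv j g).symm x) :=
  LinearMap.congr_fun (pull_comp j (g.symm : C(B, A)) (h.symm : C(C, B))) x

lemma pairing_pullEquiv_symm_pushEquiv (j : ℕ) (g : A ≃ₜ B) (x : coH j A) (y : H j A) :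
    pairing j B ((pullEquiv j g).symm x) (pushEquiv j g y) = pairing j A x y := by
  obtain ⟨x, rfl⟩ := (pullEquiv j g).surjective x
  rw [LinearEquiv.symm_apply_apply]
  exact (pairing_pull j (g : C(A, B)) x y).symm

end Duality

section TrivialFamily

variable {Y F : Type u} {T : Type v} [TopologicalSpace Y] [TopologicalSpace F] [TopologicalSpace T]
  {ρ : Y → T} (Φ : Y ≃ₜ T × F) (hΦ : ∀ y, (Φ y).1 = ρ y)

/-- The identification of the fiber over `t` of the family `ρ` with `F`, given by a trivialization
`Φ` of `ρ`. -/
def fiberHomeomorph (t : T) : Fiber ρ t ≃ₜ F where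
  toFun y := (Φ y.1).2
  invFun x := ⟨Φ.symm (t, x), by simp [← hΦ]⟩
  left_inv y := Subtype.ext <| by
    have h : (t, (Φ y.1).2) = Φ y.1 := Prod.ext ((hΦ y.1).trans y.2).symm rfl
    simp [h]
  right_inv x := by simp

lemma homotopic_fiberIncl_comp_fiberHomeomorph_symm {U : Set T} {t t' : T} (h : JoinedIn U t t') :
    ((fiberIncl ρ U t h.source_mem).comp
        ((fiberHomeomorph Φ hΦ t).symm : C(F, Fiber ρ t))).Homotopic
      ((fiberIncl ρ U t' h.target_mem).comp
        ((fiberHomeomorph Φ hΦ t').symm : C(F, Fiber ρ t'))) :=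
  ⟨{  toFun p := ⟨Φ.symm (h.somePath p.1, p.2), by simp [← hΦ, h.somePath_mem p.1]⟩
      map_zero_left x := by simp [fiberIncl, fiberHomeomorph]
      map_one_left x := by simp [fiberIncl, fiberHomeomorph] }⟩

lemma exists_comp_fiberIncl_eq_fiberHomeomorph (U : Set T) :
    ∃ q : C(ρ ⁻¹' U, F), ∀ (t : T) (ht : t ∈ U),
      q.comp (fiberIncl ρ U t ht) = fiberHomeomorph Φ hΦ t :=
  ⟨⟨fun y => (Φ y.1).2, by fun_prop⟩, fun _ _ => rfl⟩

include hΦ in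
lemma isHomologySection_iff [PathConnectedSpace T] (j : ℕ) (a : ∀ t : T, H j (Fiber ρ t)) :
    IsHomologySection ρ j a ↔
      ∃ b : H j F, ∀ t, a t = (pushEquiv j (fiberHomeomorph Φ hΦ t)).symm b := by
  obtain ⟨t₀⟩ := PathConnectedSpace.nonempty (X := T)
  constructor
  · intro ha
    have hconst : IsLocallyConstant fun t => pushEquiv j (fiberHomeomorph Φ hΦ t) (a t) := by
      rw [IsLocallyConstant.iff_eventually_eq]
      intro t₁
      obtain ⟨U, hU, ht₁, c, hc⟩ := ha t₁
      obtain ⟨q, hq⟩ := exists_comp_fiberIncl_eq_fiberHomeomorph Φ hΦ U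
      have hval (t : T) (ht : t ∈ U) : pushEquiv j (fiberHomeomorph Φ hΦ t) (a t) = push j q c := by
        rw [← hc t ht, ← LinearMap.comp_apply, ← push_comp, hq, ← coe_pushEquiv]
        rfl
      filter_upwards [hU.mem_nhds ht₁] with t ht
      rw [hval t ht, hval t₁ ht₁]
    exact ⟨_, fun t => (LinearEquiv.eq_symm_apply _).2
      (hconst.apply_eq_of_preconnectedSpace t t₀)⟩
  · rintro ⟨b, hb⟩ t₁
    refine ⟨Set.univ, isOpen_univ, trivial, push j (fiberIncl ρ Set.univ t₁ trivial) (a t₁),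
      fun t ht => ?_⟩
    have h := push_congr j (homotopic_fiberIncl_comp_fiberHomeomorph_symm Φ hΦ
      (joinedIn_univ.2 (PathConnectedSpace.joined t t₁)))
    rw [push_comp, push_comp] at h
    rw [hb, hb]
    exact LinearMap.congr_fun h b

include hΦ in
lemma isCohomologySection_iff [ConnectedSpace T] [LocallyPathConnectedSpace T] (j : ℕ)
    (a : ∀ t : T, coH j (Fiber ρ t)) :
    IsCohomologySection ρ j a ↔
      ∃ b : coH j F, ∀ t, a t = pullEquiv j (fiberHomeomorph Φ hΦ t) b := by
  obtain ⟨t₀⟩ := ConnectedSpace.toNonempty (α := T)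
  constructor
  · intro ha
    have hconst : IsLocallyConstant fun t => (pullEquiv j (fiberHomeomorph Φ hΦ t)).symm (a t) := by
      rw [IsLocallyConstant.iff_eventually_eq]
      intro t₁
      obtain ⟨U, hU, ht₁, c, hc⟩ := ha t₁
      filter_upwards [pathComponentIn_mem_nhds (hU.mem_nhds ht₁)] with t (ht : JoinedIn U t₁ t)
      have h := pull_congr j (homotopic_fiberIncl_comp_fiberHomeomorph_symm Φ hΦ ht.symm)
      rw [pull_comp, pull_comp] at h
      rw [hc t ht.target_mem, hc t₁ ht₁]
      exact LinearMap.congr_fun h c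
    exact ⟨_, fun t => (LinearEquiv.symm_apply_eq _).1
      (hconst.apply_eq_of_preconnectedSpace t t₀)⟩
  · rintro ⟨b, hb⟩ t₁
    obtain ⟨q, hq⟩ := exists_comp_fiberIncl_eq_fiberHomeomorph Φ hΦ Set.univ
    refine ⟨Set.univ, isOpen_univ, trivial, pull j q b, fun t ht => ?_⟩
    rw [hb, ← LinearMap.comp_apply, ← pull_comp, hq]
    rfl

lemma exists_isHomologySection_iff [PathConnectedSpace T] (j : ℕ) {t₀ t₁ : T}
    (y₀ : H j (Fiber ρ t₀)) (y₁ : H j (Fiber ρ t₁)) :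
    (∃ a, IsHomologySection ρ j a ∧ a t₀ = y₀ ∧ a t₁ = y₁) ↔
      pushEquiv j (fiberHomeomorph Φ hΦ t₀) y₀ = pushEquiv j (fiberHomeomorph Φ hΦ t₁) y₁ := by
  simp only [isHomologySection_iff Φ hΦ]
  constructor
  · rintro ⟨a, ⟨b, hb⟩, rfl, rfl⟩
    simp only [hb, LinearEquiv.apply_symm_apply]
  · intro h
    refine ⟨fun t => (pushEquiv j (fiberHomeomorph Φ hΦ t)).symm
      (pushEquiv j (fiberHomeomorph Φ hΦ t₀) y₀), ⟨_, fun t => rfl⟩, ?_, ?_⟩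
    · exact LinearEquiv.symm_apply_apply _ y₀
    · exact (LinearEquiv.symm_apply_eq _).2 h

lemma exists_isCohomologySection_iff [ConnectedSpace T] [LocallyPathConnectedSpace T]
    (j : ℕ) {t₀ t₁ : T} (x₀ : coH j (Fiber ρ t₀)) (x₁ : coH j (Fiber ρ t₁)) :
    (∃ a, IsCohomologySection ρ j a ∧ a t₀ = x₀ ∧ a t₁ = x₁) ↔
      (pullEquiv j (fiberHomeomorph Φ hΦ t₀)).symm x₀ =
        (pullEquiv j (fiberHomeomorph Φ hΦ t₁)).symm x₁ := by
  simp only [isCohomologySection_iff Φ hΦ]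
  constructor
  · rintro ⟨a, ⟨b, hb⟩, rfl, rfl⟩
    simp only [hb, LinearEquiv.symm_apply_apply]
  · intro h
    refine ⟨fun t => pullEquiv j (fiberHomeomorph Φ hΦ t)
      ((pullEquiv j (fiberHomeomorph Φ hΦ t₀)).symm x₀), ⟨_, fun t => rfl⟩, ?_, ?_⟩
    · exact LinearEquiv.apply_symm_apply _ x₀
    · exact (LinearEquiv.eq_symm_apply _).1 h

end TrivialFamily

section LocallyTrivial

variable {X : Type u} {S : Type v} [TopologicalSpace X] [TopologicalSpace S] {f : X → S}

lemma exists_trivialization_of_homeomorph {F : Type*} [TopologicalSpace F] [Nonempty (X → F)]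
    {U : Set S} (hU : IsOpen U) (hU' : U.Nonempty) (hfU : IsOpen (f ⁻¹' U)) (k : f ⁻¹' U ≃ₜ U × F)
    (hk : ∀ x, ((k x).1 : S) = f x) : ∃ e : Bundle.Trivialization F f, e.baseSet = U := by
  let e : Bundle.Trivialization F fun x : f ⁻¹' U => (⟨f x, x.2⟩ : U) :=
    { toOpenPartialHomeomorph := k.toOpenPartialHomeomorph
      baseSet := Set.univ
      open_baseSet := isOpen_univ
      source_eq := rfl
      target_eq := Set.univ_prod_univ.symm
      proj_toFun := fun x _ => Subtype.ext (hk x) }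
  exact ⟨(e.codExtend hU hU').domExtend hfU, Subtype.coe_image_univ U⟩

variable {T : Type*} [TopologicalSpace T] {φ : T → S} {F : Type*} [TopologicalSpace F]

/-- The trivialization over `φ ⁻¹' e.baseSet` of the base change of `f` along `φ`, obtained from a
trivialization `e` of `f`. -/
def pullbackPreimageHomeomorph (hφ : Continuous φ) (e : Bundle.Trivialization F f) :
    (Function.Pullback.fst : φ.Pullback f → T) ⁻¹' (φ ⁻¹' e.baseSet) ≃ₜ
      (φ ⁻¹' e.baseSet) × F where
  toFun y := (⟨y.1.1.1, y.2⟩, (e y.1.1.2).2)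
  invFun p := ⟨⟨(p.1, e.toOpenPartialHomeomorph.symm (φ p.1, p.2)),
    (e.proj_symm_apply' p.1.2).symm⟩, p.1.2⟩
  left_inv y := Subtype.ext <| Subtype.ext <| Prod.ext rfl <| by
    have hy : f y.1.1.2 ∈ e.baseSet := y.1.2 ▸ y.2
    change e.toOpenPartialHomeomorph.symm (φ y.1.1.1, (e y.1.1.2).2) = y.1.1.2
    rw [show φ y.1.1.1 = f y.1.1.2 from y.1.2, e.symm_apply_mk_proj (e.mem_source.2 hy)]
  right_inv p := Prod.ext rfl <| by
    change (e (e.toOpenPartialHomeomorph.symm (φ p.1, p.2))).2 = p.2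
    rw [e.apply_symm_apply' p.1.2]
  continuous_toFun := by
    have hsnd : Continuous fun y : (Function.Pullback.fst : φ.Pullback f → T) ⁻¹'
        (φ ⁻¹' e.baseSet) => e y.1.1.2 :=
      e.continuousOn_toFun.comp_continuous (by fun_prop)
        fun y => e.mem_source.2 (y.1.2 ▸ y.2)
    exact (Continuous.subtype_mk (by fun_prop) _).prodMk hsnd.snd
  continuous_invFun := by
    have hsymm : Continuous fun p : (φ ⁻¹' e.baseSet) × F =>
        e.toOpenPartialHomeomorph.symm (φ p.1, p.2) :=
      e.continuousOn_invFun.comp_continuous (by fun_prop) fun p => e.mem_target.2 p.1.2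
    fun_prop

lemma exists_pullback_trivialization (hφ : Continuous φ) (e : Bundle.Trivialization F f) {t : T}
    (ht : φ t ∈ e.baseSet) :
    ∃ e' : Bundle.Trivialization F (Function.Pullback.fst : φ.Pullback f → T), t ∈ e'.baseSet := by
  have : Nonempty (φ.Pullback f → F) := ⟨fun y => (e y.snd).2⟩
  have hU := e.open_baseSet.preimage hφ
  have hfst : Continuous (Function.Pullback.fst : φ.Pullback f → T) :=
    continuous_fst.comp continuous_subtype_val
  obtain ⟨e', he'⟩ := exists_trivialization_of_homeomorph hU ⟨t, ht⟩ (hU.preimage hfst)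
    (pullbackPreimageHomeomorph hφ e) fun _ => rfl
  exact ⟨e', he' ▸ ht⟩

lemma IsLocallyTrivial.pullback (hf : IsLocallyTrivial f) (hφ : Continuous φ) :
    IsLocallyTrivial (Function.Pullback.fst : φ.Pullback f → T) := fun t => by
  obtain ⟨e, he⟩ := hf (φ t)
  obtain ⟨e', he'⟩ := exists_pullback_trivialization hφ e he
  exact ⟨e'.transFiberHomeomorph (e'.preimageSingletonHomeomorph he').symm, he'⟩

lemma IsLocallyTrivial.nonempty_homeomorph_fiber [PreconnectedSpace S] (hf : IsLocallyTrivial f)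
    (s t : S) : Nonempty (Fiber f s ≃ₜ Fiber f t) := by
  refine isPreconnected_univ.induction₂ (fun s t => Nonempty (Fiber f s ≃ₜ Fiber f t))
    (fun s _ => ?_) (fun _ _ _ _ _ _ ⟨h⟩ ⟨h'⟩ => ⟨h.trans h'⟩) (fun _ _ _ _ ⟨h⟩ => ⟨h.symm⟩)
    trivial trivial
  rw [nhdsWithin_univ]
  obtain ⟨e, he⟩ := hf s
  filter_upwards [e.open_baseSet.mem_nhds he] with t ht
  exact ⟨(e.preimageSingletonHomeomorph ht).symm⟩

lemma IsLocallyTrivial.exists_trivialization [PreconnectedSpace S] (hf : IsLocallyTrivial f)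
    (s t : S) : ∃ e : Bundle.Trivialization (Fiber f s) f, t ∈ e.baseSet := by
  obtain ⟨e, he⟩ := hf t
  obtain ⟨k⟩ := hf.nonempty_homeomorph_fiber t s
  exact ⟨e.transFiberHomeomorph k, he⟩

end LocallyTrivial

section UnitInterval

variable {F Z : Type*} [TopologicalSpace F] [TopologicalSpace Z] {p : Z → I}

lemma exists_trivialization_baseSet_eq_univ
    (h : ∀ t, ∃ e : Bundle.Trivialization F p, t ∈ e.baseSet) :
    ∃ e : Bundle.Trivialization F p, e.baseSet = Set.univ := by
  choose e he using h
  obtain ⟨t, h0, ht, ⟨m, hm⟩, hcov⟩ := exists_monotone_Icc_subset_open_cover_unitInterval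
    (fun i => (e i).open_baseSet) (fun i _ => Set.mem_iUnion.2 ⟨i, he i⟩)
  have hprefix : ∀ n, ∃ e : Bundle.Trivialization F p, Set.Icc 0 (t n) ⊆ e.baseSet := by
    intro n
    induction n with
    | zero => exact ⟨e 0, by simpa [h0] using he 0⟩
    | succ n ih =>
      obtain ⟨e₁, h₁⟩ := ih
      obtain ⟨i, hi⟩ := hcov n
      refine ⟨e₁.piecewiseLe (e i) (t n) (h₁ ⟨nonneg', le_rfl⟩)
        (hi ⟨le_rfl, ht n.le_succ⟩), Set.subset_ite.2 ?_⟩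
      exact ⟨fun x hx => h₁ ⟨hx.1.1, hx.2⟩, fun x hx => hi ⟨(not_le.1 hx.2).le, hx.1.2⟩⟩
  obtain ⟨e', he'⟩ := hprefix m
  refine ⟨e', Set.eq_univ_of_forall fun x => he' ⟨nonneg', ?_⟩⟩
  rw [hm m le_rfl]
  exact le_one'

end UnitInterval

lemma isHomeomorphicTrivialFiberBundle_of_baseSet_eq_univ {F Z B : Type*} [TopologicalSpace F]
    [TopologicalSpace Z] [TopologicalSpace B] {p : Z → B} (e : Bundle.Trivialization F p)
    (he : e.baseSet = Set.univ) : IsHomeomorphicTrivialFiberBundle F p := by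
  have hsource : e.source = Set.univ := by rw [e.source_eq, he, Set.preimage_univ]
  have htarget : e.target = Set.univ := by rw [e.target_eq, he, Set.univ_prod_univ]
  exact ⟨e.toOpenPartialHomeomorph.toHomeomorphOfSourceEqUnivTargetEqUniv hsource htarget,
    fun x => e.coe_fst (hsource ▸ Set.mem_univ x)⟩

lemma IsLocallyTrivial.isHomeomorphicTrivialFiberBundle {Y : Type u} [TopologicalSpace Y]
    {ρ : Y → I} (hρ : IsLocallyTrivial ρ) (t : I) :
    IsHomeomorphicTrivialFiberBundle (Fiber ρ t) ρ := by
  obtain ⟨e, he⟩ := exists_trivialization_baseSet_eq_univ (hρ.exists_trivialization t)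
  exact isHomeomorphicTrivialFiberBundle_of_baseSet_eq_univ e he

section Loop

variable {X : Type u} {S : Type v} [TopologicalSpace X] [TopologicalSpace S]
  {f : X → S} {s : S} {γ : Path s s}

lemma isGeometricMonodromy_of_trivialization {F : Type u} [TopologicalSpace F]
    (Φ : BaseChange f γ ≃ₜ I × F) (hΦ : ∀ y, (Φ y).1 = proj f γ y) :
    IsGeometricMonodromy f γ (((identZero f γ).trans (fiberHomeomorph Φ hΦ 0)).trans
      ((identOne f γ).trans (fiberHomeomorph Φ hΦ 1)).symm) :=
  ⟨F, inferInstance, Φ, hΦ, fun x =>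
    ((identOne f γ).trans (fiberHomeomorph Φ hΦ 1)).apply_symm_apply
      ((identZero f γ).trans (fiberHomeomorph Φ hΦ 0) x)⟩

lemma IsLocallyTrivial.exists_isGeometricMonodromy (hf : IsLocallyTrivial f) (γ : Path s s) :
    ∃ g, IsGeometricMonodromy f γ g := by
  have hproj : IsLocallyTrivial (proj f γ) := hf.pullback γ.continuous
  obtain ⟨Φ, hΦ⟩ := hproj.isHomeomorphicTrivialFiberBundle 0
  exact ⟨_, isGeometricMonodromy_of_trivialization Φ hΦ⟩

lemma IsGeometricMonodromy.exists_trans_eq {g : Fiber f s ≃ₜ Fiber f s}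
    (hg : IsGeometricMonodromy f γ g) :
    ∃ (F : Type u) (_ : TopologicalSpace F) (Φ : BaseChange f γ ≃ₜ I × F)
      (hΦ : ∀ y, (Φ y).1 = proj f γ y),
      g.trans ((identOne f γ).trans (fiberHomeomorph Φ hΦ 1)) =
        (identZero f γ).trans (fiberHomeomorph Φ hΦ 0) := by
  obtain ⟨F, _, Φ, hΦ, hΦg⟩ := hg
  exact ⟨F, inferInstance, Φ, hΦ, Homeomorph.ext hΦg⟩

lemma IsGeometricMonodromy.isHomologyMonodromy {g : Fiber f s ≃ₜ Fiber f s}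
    (hg : IsGeometricMonodromy f γ g) (j : ℕ) : IsHomologyMonodromy f γ j (pushEquiv j g) := by
  obtain ⟨F, _, Φ, hΦ, hΦg⟩ := hg.exists_trans_eq
  intro x x'
  have := isPathConnected_iff_pathConnectedSpace.1
    ((convex_Icc (0 : ℝ) 1).isPathConnected ⟨0, by simp⟩)
  rw [exists_isHomologySection_iff Φ hΦ]
  change _ ↔ pushEquiv j _ (pushEquiv j (identZero f γ) x) =
    pushEquiv j _ (pushEquiv j (identOne f γ) x')
  rw [← pushEquiv_trans_apply, ← pushEquiv_trans_apply, ← hΦg, pushEquiv_trans_apply,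
    EmbeddingLike.apply_eq_iff_eq]

lemma IsGeometricMonodromy.isCohomologyMonodromy {g : Fiber f s ≃ₜ Fiber f s}
    (hg : IsGeometricMonodromy f γ g) (j : ℕ) :
    IsCohomologyMonodromy f γ j (pullEquiv j g).symm := by
  obtain ⟨F, _, Φ, hΦ, hΦg⟩ := hg.exists_trans_eq
  intro x x'
  have := (convex_Icc (0 : ℝ) 1).locallyPathConnectedSpace
  change _ ↔ ∃ a, IsCohomologySection (proj f γ) j a ∧ pullEquiv j (identZero f γ) (a 0) = x ∧
    pullEquiv j (identOne f γ) (a 1) = x'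
  simp only [← LinearEquiv.eq_symm_apply]
  rw [exists_isCohomologySection_iff Φ hΦ, ← pullEquiv_trans_symm_apply,
    ← pullEquiv_trans_symm_apply, ← hΦg, pullEquiv_trans_symm_apply, EmbeddingLike.apply_eq_iff_eq,
    LinearEquiv.eq_symm_apply]

lemma IsHomologyMonodromy.unique {j : ℕ} {γh γh' : H j (Fiber f s) ≃ₗ[ℚ] H j (Fiber f s)}
    (h : IsHomologyMonodromy f γ j γh) (h' : IsHomologyMonodromy f γ j γh') : γh = γh' :=
  LinearEquiv.ext fun x => (h x _).2 ((h' x _).1 rfl)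

lemma IsCohomologyMonodromy.unique {j : ℕ}
    {γc γc' : coH j (Fiber f s) ≃ₗ[ℚ] coH j (Fiber f s)}
    (h : IsCohomologyMonodromy f γ j γc) (h' : IsCohomologyMonodromy f γ j γc') : γc = γc' :=
  LinearEquiv.ext fun x => (h x _).2 ((h' x _).1 rfl)

end Loop

end Monodromy

end

theorem mainTheorem3_general {X : Type u} {S : Type v} [TopologicalSpace X] [TopologicalSpace S]
    (f : X → S) (hloc : Monodromy.IsLocallyTrivial f) (s : S) (γ : Path s s) :
    (∃ g, Monodromy.IsGeometricMonodromy f γ g) ∧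
    ∀ j : ℕ,
      Function.Bijective (Monodromy.pairing j (Monodromy.Fiber f s)) ∧
      ∃ (γh : Monodromy.H j (Monodromy.Fiber f s) ≃ₗ[ℚ] Monodromy.H j (Monodromy.Fiber f s))
        (γc : Monodromy.coH j (Monodromy.Fiber f s) ≃ₗ[ℚ] Monodromy.coH j (Monodromy.Fiber f s)),
        Monodromy.IsHomologyMonodromy f γ j γh ∧
        Monodromy.IsCohomologyMonodromy f γ j γc ∧
        (∀ x y, Monodromy.pairing j (Monodromy.Fiber f s) (γc x) (γh y) =
          Monodromy.pairing j (Monodromy.Fiber f s) x y) ∧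
        ∀ g : Monodromy.Fiber f s ≃ₜ Monodromy.Fiber f s, Monodromy.IsGeometricMonodromy f γ g →
          Monodromy.push j (g : C(Monodromy.Fiber f s, Monodromy.Fiber f s)) = γh ∧
          Monodromy.pull j (g : C(Monodromy.Fiber f s, Monodromy.Fiber f s)) = γc.symm ∧
          ∀ x y,
            Monodromy.pairing j (Monodromy.Fiber f s)
              (Monodromy.pull j (g : C(Monodromy.Fiber f s, Monodromy.Fiber f s)) x) y =
            Monodromy.pairing j (Monodromy.Fiber f s) x
              (Monodromy.push j (g : C(Monodromy.Fiber f s, Monodromy.Fiber f s)) y) := by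
  obtain ⟨g, hg⟩ := hloc.exists_isGeometricMonodromy γ
  refine ⟨⟨g, hg⟩, fun j => ⟨⟨Monodromy.pairing_injective j _, Monodromy.pairing_surjective j _⟩,
    Monodromy.pushEquiv j g, (Monodromy.pullEquiv j g).symm, hg.isHomologyMonodromy j,
    hg.isCohomologyMonodromy j, Monodromy.pairing_pullEquiv_symm_pushEquiv j g,
    fun g' hg' => ⟨?_, ?_, Monodromy.pairing_pull j _⟩⟩⟩
  · rw [(hg.isHomologyMonodromy j).unique (hg'.isHomologyMonodromy j), Monodromy.coe_pushEquiv]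
  · rw [(hg.isCohomologyMonodromy j).unique (hg'.isCohomologyMonodromy j),
      LinearEquiv.symm_symm, Monodromy.coe_pullEquiv]

theorem mainTheorem3 {X : Type u} {S : Type v} [TopologicalSpace X] [TopologicalSpace S]
    (f : X → S) (hf : Continuous f) (hloc : Monodromy.IsLocallyTrivial f)
    (hfinH : ∀ (t : S) (j : ℕ), FiniteDimensional ℚ (Monodromy.H j (Monodromy.Fiber f t)))
    (hfinC : ∀ (t : S) (j : ℕ), FiniteDimensional ℚ (Monodromy.coH j (Monodromy.Fiber f t)))
    (s : S) (γ : Path s s) :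
    (∃ g, Monodromy.IsGeometricMonodromy f γ g) ∧
    ∀ j : ℕ,
      (Monodromy.pairing j (Monodromy.Fiber f s)).IsPerfPair ∧
      ∃ (γh : Monodromy.H j (Monodromy.Fiber f s) ≃ₗ[ℚ] Monodromy.H j (Monodromy.Fiber f s))
        (γc : Monodromy.coH j (Monodromy.Fiber f s) ≃ₗ[ℚ] Monodromy.coH j (Monodromy.Fiber f s)),
        Monodromy.IsHomologyMonodromy f γ j γh ∧
        Monodromy.IsCohomologyMonodromy f γ j γc ∧
        (∀ x y, Monodromy.pairing j (Monodromy.Fiber f s) (γc x) (γh y) =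
          Monodromy.pairing j (Monodromy.Fiber f s) x y) ∧
        ∀ g : Monodromy.Fiber f s ≃ₜ Monodromy.Fiber f s, Monodromy.IsGeometricMonodromy f γ g →
          Monodromy.push j (g : C(Monodromy.Fiber f s, Monodromy.Fiber f s)) = γh ∧
          Monodromy.pull j (g : C(Monodromy.Fiber f s, Monodromy.Fiber f s)) = γc.symm ∧
          ∀ x y,
            Monodromy.pairing j (Monodromy.Fiber f s)
              (Monodromy.pull j (g : C(Monodromy.Fiber f s, Monodromy.Fiber f s)) x) y =
            Monodromy.pairing j (Monodromy.Fiber f s) x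
              (Monodromy.push j (g : C(Monodromy.Fiber f s, Monodromy.Fiber f s)) y) := by
  obtain ⟨hg, h⟩ := mainTheorem3_general f hloc s γ
  have := hfinH s
  exact ⟨hg, fun j => (h j).imp_left (LinearMap.IsPerfPair.of_bijective _)⟩
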